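/- Let $\Bbbk$ be an algebraically closed field, let $\Lambda$ be a finite dimensional $\Bbbk$-algebra, and let $Q=\operatorname{Hom}_{\Bbbk}(\Lambda,\Bbbk)$ with the $\Lambda$-$\Lambda$-bimodule structure $(a\varphi a')(x)=\varphi(a'xa)$. Let $\Lambda\text{-mod}$ be the category of finitely generated left $\Lambda$-modules, and let $\widehat\Lambda\text{-mod}$ be the category of finitely generated left modules over the repetitive algebra $\widehat\Lambda$ of $\Lambda$. Its objects are the families $\widehat M=(M_i,f_i)_{i\in\mathbb Z}$ of modules $M_i$ in $\Lambda\text{-mod}$, almost all zero, and $\Lambda$-linear maps $f_i:Q\otimes_\Lambda M_i\to M_{i+1}$ with $f_{i+1}\circ(\mathrm{id}_Q\otimes f_i)=0$. Its morphisms $\widehat h:\widehat M\to\widehat M'$ are the families $(h_i)_{i\in\mathbb Z}$ of $\Lambda$-linear maps $h_i:M_i\to M'_i$ with $h_{i+1}\circ f_i=f'_i\circ(\mathrm{id}_Q\otimes h_i)$. The stable category $\widehat\Lambda\text{-}\underline{\mathrm{mod}}$ has the same objects, and its morphisms are the classes $\underline{\widehat h}$ of morphisms $\widehat h$ of $\widehat\Lambda\text{-mod}$,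 where $\underline{\widehat h}=\underline{\widehat h'}$ if and only if $\widehat h-\widehat h'$ factors through a projective-injective object of $\widehat\Lambda\text{-mod}$. A morphism $f$ of a category is irreducible if it is neither a split monomorphism nor a split epimorphism and if $f=v\circ u$ always implies that $u$ is a split monomorphism or $v$ is a split epimorphism. Call $\widehat h$ smonic (respectively sepic) if every $h_i$ is a split monomorphism (respectively a split epimorphism) in $\Lambda\text{-mod}$. Call $\widehat h$ sirreducible if $\widehat h$ is irreducible in $\widehat\Lambda\text{-mod}$ and there is $i_0\in\mathbb Z$ such that $h_{i_0}$ is irreducible in $\Lambda\text{-mod}$ and $i_0$ is the only index $i$ for which $h_i$ is neither a split monomorphism nor a split epimorphism. A morphism of the stable category is called stably smonic (respectively stably sepic, stably sirreducible) if its representatives in $\widehat\Lambda\text{-mod}$ are all smonic (respectively sepic, sirreducible). **Theorem.** Let $\underline{\widehat h}:\widehat M\to\widehat M'$ be an irreducible morphism of $\widehat\Lambda\text{-}\underline{\mathrm{mod}}$. Assume that $\widehat M$ or $\widehat M'$ is an indecomposable $\widehat\Lambda$-module and that neither $\widehat M$ nor $\widehat M'$ has a nonzero projective direct summand in $\widehat\Lambda\text{-mod}$.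 Then $\underline{\widehat h}$ is stably smonic, stably sepic or stably sirreducible. -/

import Mathlib

open CategoryTheory CategoryTheory.Limits

universe u

noncomputable section

/-- A morphism `f` of a category is *irreducible* if it is neither a split monomorphism nor a
split epimorphism and, whenever `f` factors as `u` followed by `v`, either `u` is a split
monomorphism or `v` is a split epimorphism. -/
def IsIrreducibleMor {C : Type*} [Category C] {X Y : C} (f : X ⟶ Y) : Prop :=
  ¬ IsSplitMono f ∧ ¬ IsSplitEpi f ∧
    ∀ ⦃Z : C⦄ (u : X ⟶ Z) (v : Z ⟶ Y), u ≫ v = f → IsSplitMono u ∨ IsSplitEpi v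

section Repetitive

variable (k Λ : Type u) [Field k] [Ring Λ] [Algebra k Λ]

/-- The left action of `Λ` on `Q = D Λ = Hom_k (Λ, k)`: `(a φ) x = φ (x a)`. -/
def dualLeft (a : Λ) (φ : Module.Dual k Λ) : Module.Dual k Λ :=
  φ.comp (LinearMap.mulRight k a)

/-- The right action of `Λ` on `Q = D Λ = Hom_k (Λ, k)`: `(φ a) x = φ (a x)`. -/
def dualRight (φ : Module.Dual k Λ) (a : Λ) : Module.Dual k Λ :=
  φ.comp (LinearMap.mulLeft k a)

/-- A finitely generated left module over the repetitive algebra of `Λ`: a family `M i`, `i ∈ ℤ`,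
of finitely generated left `Λ`-modules, almost all of them zero, with morphisms of left
`Λ`-modules `f i : Q ⊗_Λ M i → M (i + 1)` such that `f (i + 1) ∘ (id_Q ⊗ f i) = 0`.

A morphism of left `Λ`-modules out of `Q ⊗_Λ M i` is given, through the universal property of the
tensor product over the noncommutative ring `Λ`, by the biadditive map `act i : Q × M i → M (i + 1)`
with `act i (φ a) m = act i φ (a m)` (balanced) and `act i (a φ) m = a (act i φ m)`
(compatible with the left action of `Λ` on `Q`). -/
structure RepMod where
  /-- the `Λ`-module in degree `i` -/
  obj : ℤ → FGModuleCat.{u} Λ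
  /-- almost all of the components are zero -/
  finite_support : {i : ℤ | Nontrivial (obj i)}.Finite
  /-- `act i φ m` is the value at `φ ⊗ m` of the morphism `Q ⊗_Λ M i → M (i + 1)` -/
  act : ∀ i : ℤ, Module.Dual k Λ →+ obj i →+ obj (i + 1)
  act_balanced : ∀ (i : ℤ) (φ : Module.Dual k Λ) (a : Λ) (m : obj i),
    act i (dualRight k Λ φ a) m = act i φ (a • m)
  act_smul : ∀ (i : ℤ) (a : Λ) (φ : Module.Dual k Λ) (m : obj i),
    act i (dualLeft k Λ a φ) m = a • act i φ m
  act_act : ∀ (i : ℤ) (φ ψ : Module.Dual k Λ) (m : obj i), act (i + 1) φ (act i ψ m) = 0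

namespace RepMod

variable {k Λ}

/-- A morphism of modules over the repetitive algebra: a family of morphisms of `Λ`-modules
`h i : M i → N i` that commutes with the structure maps. -/
@[ext]
structure Hom (M N : RepMod k Λ) where
  /-- the component morphism in degree `i` -/
  app : ∀ i : ℤ, M.obj i ⟶ N.obj i
  comm : ∀ (i : ℤ) (φ : Module.Dual k Λ) (m : M.obj i),
    (app (i + 1)).hom.hom (M.act i φ m) = N.act i φ ((app i).hom.hom m)

/-- The category of finitely generated modules over the repetitive algebra of `Λ`. -/
instance : Category (RepMod k Λ) where
  Hom := Hom
  id M := { app := fun i => 𝟙 (M.obj i), comm := fun _ _ _ => rfl }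
  comp f g :=
    { app := fun i => f.app i ≫ g.app i
      comm := fun i φ m => by simp [f.comm, g.comm] }

@[ext]
theorem hom_ext {M N : RepMod k Λ} {f g : M ⟶ N} (h : ∀ i, f.app i = g.app i) : f = g :=
  Hom.ext (funext h)

@[simp]
theorem id_app (M : RepMod k Λ) (i : ℤ) : Hom.app (𝟙 M) i = 𝟙 (M.obj i) := rfl

@[simp]
theorem comp_app {M N P : RepMod k Λ} (f : M ⟶ N) (g : N ⟶ P) (i : ℤ) :
    (f ≫ g).app i = f.app i ≫ g.app i := rfl

variable {M N : RepMod k Λ}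

instance : Zero (M ⟶ N) :=
  ⟨{ app := fun _ => 0, comm := fun i φ _ => (map_zero (N.act i φ)).symm }⟩

instance : Add (M ⟶ N) :=
  ⟨fun f g =>
    { app := fun i => f.app i + g.app i
      comm := fun i φ m => by
        have h : N.act i φ ((f.app i).hom.hom m + (g.app i).hom.hom m) =
          N.act i φ ((f.app i).hom.hom m) + N.act i φ ((g.app i).hom.hom m) := map_add _ _ _
        rw [← f.comm, ← g.comm] at h
        exact h.symm }⟩

instance : Neg (M ⟶ N) :=
  ⟨fun f =>
    { app := fun i => - f.app i
      comm := fun i φ m => by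
        have h : N.act i φ (- (f.app i).hom.hom m) = - N.act i φ ((f.app i).hom.hom m) :=
          map_neg _ _
        rw [← f.comm] at h
        exact h.symm }⟩

@[simp]
theorem zero_app (i : ℤ) : Hom.app (0 : M ⟶ N) i = 0 := rfl

@[simp]
theorem add_app (f g : M ⟶ N) (i : ℤ) : (f + g).app i = f.app i + g.app i := rfl

@[simp]
theorem neg_app (f : M ⟶ N) (i : ℤ) : (-f).app i = -f.app i := rfl

instance : AddCommGroup (M ⟶ N) where
  add_assoc _ _ _ := hom_ext fun _ => add_assoc _ _ _
  zero_add _ := hom_ext fun _ => zero_add _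
  add_zero _ := hom_ext fun _ => add_zero _
  add_comm _ _ := hom_ext fun _ => add_comm _ _
  neg_add_cancel _ := hom_ext fun _ => neg_add_cancel _
  nsmul := nsmulRec
  zsmul := zsmulRec

/-- Morphisms are added componentwise. -/
instance : Preadditive (RepMod k Λ) where
  add_comp _ _ _ _ _ _ := hom_ext fun _ => Preadditive.add_comp _ _ _ _ _ _
  comp_add _ _ _ _ _ _ := hom_ext fun _ => Preadditive.comp_add _ _ _ _ _ _

/-- The direct sum of two modules over the repetitive algebra, formed componentwise. -/
def prod (M N : RepMod k Λ) : RepMod k Λ where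
  obj i := FGModuleCat.of Λ (M.obj i × N.obj i)
  finite_support := by
    refine (M.finite_support.union N.finite_support).subset fun i hi => ?_
    by_contra hc
    simp only [Set.mem_union, Set.mem_ofPred_eq, not_or, not_nontrivial_iff_subsingleton] at hc
    obtain ⟨h₁, h₂⟩ := hc
    have : Subsingleton (M.obj i × N.obj i) := inferInstance
    exact not_nontrivial (M.obj i × N.obj i) hi
  act i :=
    { toFun := fun φ => (M.act i φ).prodMap (N.act i φ)
      map_zero' := by ext x <;> simp
      map_add' := fun φ ψ => by ext x <;> simp }
  act_balanced i φ a m := Prod.ext (M.act_balanced i φ a m.1) (N.act_balanced i φ a m.2)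
  act_smul i a φ m := Prod.ext (M.act_smul i a φ m.1) (N.act_smul i a φ m.2)
  act_act i φ ψ m := Prod.ext (M.act_act i φ ψ m.1) (N.act_act i φ ψ m.2)

/-- The direct sum with its projections and injections. -/
def prodBicone (M N : RepMod k Λ) : BinaryBicone M N where
  pt := prod M N
  fst :=
    { app := fun i => FGModuleCat.ofHom (LinearMap.fst Λ (M.obj i) (N.obj i))
      comm := fun _ _ _ => rfl }
  snd :=
    { app := fun i => FGModuleCat.ofHom (LinearMap.snd Λ (M.obj i) (N.obj i))
      comm := fun _ _ _ => rfl }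
  inl :=
    { app := fun i => FGModuleCat.ofHom (LinearMap.inl Λ (M.obj i) (N.obj i))
      comm := fun i φ _ => Prod.ext rfl (map_zero (N.act i φ)).symm }
  inr :=
    { app := fun i => FGModuleCat.ofHom (LinearMap.inr Λ (M.obj i) (N.obj i))
      comm := fun i φ _ => Prod.ext (map_zero (M.act i φ)).symm rfl }
  inl_fst := rfl
  inl_snd := rfl
  inr_fst := rfl
  inr_snd := rfl

instance : HasBinaryBiproducts (RepMod k Λ) where
  has_binary_biproduct M N := hasBinaryBiproduct_of_total (prodBicone M N) <| by
    refine hom_ext fun i => FGModuleCat.hom_ext (LinearMap.ext fun x => ?_)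
    exact Prod.ext (add_zero _) (zero_add _)

/-- `M` has no projective direct summands: every direct summand (retract) of `M` that is
projective as a module over the repetitive algebra is zero. -/
def NoProjectiveSummand (M : RepMod k Λ) : Prop :=
  ∀ P : RepMod k Λ, Projective P → Nonempty (Retract P M) → IsZero P

/-- `h` is smonic if all of its components are split monomorphisms of `Λ`-modules. -/
def Smonic (h : M ⟶ N) : Prop := ∀ i : ℤ, IsSplitMono (h.app i)

/-- `h` is sepic if all of its components are split epimorphisms of `Λ`-modules. -/
def Sepic (h : M ⟶ N) : Prop := ∀ i : ℤ, IsSplitEpi (h.app i)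

/-- `h` is sirreducible if it is irreducible over the repetitive algebra and there is a degree `i₀`
such that the component in degree `i₀` is irreducible as a morphism of finitely generated
`Λ`-modules and `i₀` is the only degree in which the component is neither a split monomorphism
nor a split epimorphism. -/
def Sirreducible (h : M ⟶ N) : Prop :=
  IsIrreducibleMor h ∧ ∃ i₀ : ℤ, IsIrreducibleMor (h.app i₀) ∧
    ∀ i : ℤ, ¬ IsSplitMono (h.app i) → ¬ IsSplitEpi (h.app i) → i = i₀

end RepMod

/-- Two morphisms are identified in the stable category if their difference factors through a
projective-injective object. -/
def stableRel : HomRel (RepMod k Λ) := fun M N f g =>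
  ∃ (P : RepMod k Λ) (u : M ⟶ P) (v : P ⟶ N), Projective P ∧ Injective P ∧ f - g = u ≫ v

/-- `stableRel` is a congruence, so that the quotient below makes no further identifications. -/
instance : Congruence (stableRel k Λ) where
  comp_left := by
    rintro X Y Z f g g' ⟨P, u, v, h₁, h₂, h⟩
    exact ⟨P, f ≫ u, v, h₁, h₂, by rw [← Preadditive.comp_sub, h, Category.assoc]⟩
  comp_right := by
    rintro X Y Z f f' g ⟨P, u, v, h₁, h₂, h⟩
    exact ⟨P, u, v ≫ g, h₁, h₂, by rw [← Preadditive.sub_comp, h, Category.assoc]⟩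
  equivalence := by
    intro X Y
    refine ⟨fun f => ?_, ?_, ?_⟩
    · let Z : RepMod k Λ :=
        { obj := fun _ => FGModuleCat.of Λ PUnit
          finite_support := by
            refine Set.finite_empty.subset fun i hi => ?_
            exact not_nontrivial PUnit hi
          act := fun _ => 0
          act_balanced := fun _ _ _ _ => rfl
          act_smul := fun _ _ _ _ => rfl
          act_act := fun _ _ _ _ => rfl }
      have hZ : IsZero Z := by
        rw [IsZero.iff_id_eq_zero]
        exact RepMod.hom_ext fun i => FGModuleCat.hom_ext (LinearMap.ext fun x => rfl)
      exact ⟨Z, 0, 0, hZ.projective, hZ.injective, by simp⟩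
    · rintro f g ⟨P, u, v, h₁, h₂, h⟩
      exact ⟨P, u, -v, h₁, h₂, by rw [Preadditive.comp_neg, ← h, neg_sub]⟩
    · rintro f g e ⟨P, u, v, h₁, h₂, h⟩ ⟨P', u', v', h₁', h₂', h'⟩
      refine ⟨P ⊞ P', biprod.lift u u', biprod.desc v v', inferInstance, inferInstance, ?_⟩
      rw [biprod.lift_desc, ← h, ← h', sub_add_sub_cancel]

/-- The stable category of finitely generated modules over the repetitive algebra of `Λ`. -/
abbrev StableRepMod := CategoryTheory.Quotient (stableRel k Λ)

/-- The projection functor, which sends a morphism to its stable class. -/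
abbrev toStable : RepMod k Λ ⥤ StableRepMod k Λ :=
  CategoryTheory.Quotient.functor (stableRel k Λ)

variable {k Λ} {M N : RepMod k Λ}

/-- A morphism of the stable category is stably smonic if its representatives are smonic. -/
def StablySmonic (φ : (toStable k Λ).obj M ⟶ (toStable k Λ).obj N) : Prop :=
  ∀ h : M ⟶ N, (toStable k Λ).map h = φ → RepMod.Smonic h

/-- A morphism of the stable category is stably sepic if its representatives are sepic. -/
def StablySepic (φ : (toStable k Λ).obj M ⟶ (toStable k Λ).obj N) : Prop :=
  ∀ h : M ⟶ N, (toStable k Λ).map h = φ → RepMod.Sepic h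

/-- A morphism of the stable category is stably sirreducible if its representatives are
sirreducible. -/
def StablySirreducible (φ : (toStable k Λ).obj M ⟶ (toStable k Λ).obj N) : Prop :=
  ∀ h : M ⟶ N, (toStable k Λ).map h = φ → RepMod.Sirreducible h

end Repetitive

end

/-!
Write `mod` for the category `RepMod k Λ`. The argument compares all representatives of a stable
irreducible morphism with one of them, so it has two halves.

*One representative.* If `M` has no projective summand and `e : M ⟶ M` factors through a
projective, then `𝟙 + e` is invertible: by Fitting's lemma a power of it splits off its kernel, and
the identity of that kernel factors through the projective
(`RepMod.NoProjectiveSummand.isIso_id_add`). Hence morphisms between such modules which are stably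
split monomorphisms or epimorphisms are so already in `mod`, and every representative of a stable
irreducible morphism is irreducible in `mod`. Let `h : M ⟶ N` be irreducible in `mod`. A
factorization of a single component `h i` through `Y` extends to a factorization of `h` through the
module that is `M` below the degree `i`, `Y` in degree `i` and `N` above it
(`RepMod.exists_factorization`). Therefore, if `h i` is not a split monomorphism, all `h j` with
`j < i` are split epimorphisms; and a component that is neither a split monomorphism nor a split
epimorphism is irreducible and unique. Since `h` factors through its image, its components are all
injective or all surjective, so that such a component exists unless `h` is smonic or sepic
(`RepMod.smonic_or_sepic_or_sirreducible`).

*All representatives.* The difference `g` of two representatives factors through a projective, hence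
through a free module. In degree `i` the latter is a sum of copies of `Λ`, which are generators
there, and of copies of `Q`, which are cogenerators there. Every `Λ`-linear map from the generators
to `M i` and from `N i` to the cogenerators extends to `mod`. The first half then shows that the
maps from `M i` to the generators and from the cogenerators to `N i` lie in the radical, and so does
`g i` (`RepMod.isRadicalMor_app_of_projective`). Adding a radical morphism does not affect whether
a morphism is a split monomorphism or a split epimorphism, so the three types are the same for all
representatives.
-/

noncomputable section

/-! ### The radical of a preadditive category -/

section Radical

variable {C : Type*} [Category C] [Preadditive C]

theorem isIso_id_add_comp_swap {X Y : C} (a : X ⟶ Y) (b : Y ⟶ X) (h : IsIso (𝟙 X + a ≫ b)) :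
    IsIso (𝟙 Y + b ≫ a) := by
  obtain ⟨c, h₁, h₂⟩ := h.out
  have e₁ : a ≫ b ≫ c = 𝟙 X - c := by
    rw [← h₁]; simp
  have e₂ : c ≫ a ≫ b = 𝟙 X - c := by
    rw [← h₂]; simp
  refine ⟨𝟙 Y - b ≫ c ≫ a, ?_, ?_⟩
  · have : b ≫ a ≫ b ≫ c ≫ a = b ≫ (a ≫ b ≫ c) ≫ a := by simp
    simp only [Preadditive.comp_sub, Preadditive.add_comp, Category.comp_id, Category.id_comp,
      Category.assoc, this, e₁, Preadditive.sub_comp]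
    abel
  · have : b ≫ c ≫ a ≫ b ≫ a = b ≫ (c ≫ a ≫ b) ≫ a := by simp
    simp only [Preadditive.comp_add, Preadditive.sub_comp, Category.comp_id, Category.id_comp,
      Category.assoc, this, e₂, Preadditive.comp_sub]
    abel

/-- A morphism `g : X ⟶ Y` of a preadditive category lies in the *radical* of the category if
`𝟙 + g ≫ s` is invertible for every `s : Y ⟶ X`. -/
def IsRadicalMor {X Y : C} (g : X ⟶ Y) : Prop :=
  ∀ s : Y ⟶ X, IsIso (𝟙 X + g ≫ s)

namespace IsRadicalMor

theorem comp {X Y Z : C} {g : X ⟶ Y} (hg : IsRadicalMor g) (b : Y ⟶ Z) :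
    IsRadicalMor (g ≫ b) := fun s => by
  rw [Category.assoc]
  exact hg _

theorem precomp {X Y Z : C} {g : Y ⟶ Z} (hg : IsRadicalMor g) (a : X ⟶ Y) :
    IsRadicalMor (a ≫ g) := fun s => by
  have h : IsIso (𝟙 Y + (g ≫ s) ≫ a) := by
    rw [Category.assoc]
    exact hg _
  rw [Category.assoc]
  exact isIso_id_add_comp_swap _ _ h

theorem add {X Y : C} {f g : X ⟶ Y} (hf : IsRadicalMor f) (hg : IsRadicalMor g) :
    IsRadicalMor (f + g) := fun s => by
  have h₁ := hf s
  have h₂ := hg (s ≫ inv (𝟙 X + f ≫ s))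
  have : 𝟙 X + (f + g) ≫ s =
      (𝟙 X + g ≫ s ≫ inv (𝟙 X + f ≫ s)) ≫ (𝟙 X + f ≫ s) := by
    rw [Preadditive.add_comp _ _ _ (𝟙 X) (g ≫ _)]
    simp only [Category.assoc, IsIso.inv_hom_id, Category.comp_id, Category.id_comp,
      Preadditive.add_comp]
    abel
  rw [this]
  infer_instance

theorem isSplitMono_add {X Y : C} {f g : X ⟶ Y} (hg : IsRadicalMor g) (hf : IsSplitMono f) :
    IsSplitMono (f + g) := by
  have h := hg (retraction f)
  refine IsSplitMono.mk' ⟨retraction f ≫ inv (𝟙 X + g ≫ retraction f), ?_⟩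
  have : (f + g) ≫ retraction f = 𝟙 X + g ≫ retraction f := by simp
  rw [← Category.assoc, this, IsIso.hom_inv_id]

theorem isSplitEpi_add {X Y : C} {f g : X ⟶ Y} (hg : IsRadicalMor g) (hf : IsSplitEpi f) :
    IsSplitEpi (f + g) := by
  have h := isIso_id_add_comp_swap _ _ (hg (section_ f))
  refine IsSplitEpi.mk' ⟨inv (𝟙 Y + section_ f ≫ g) ≫ section_ f, ?_⟩
  have : section_ f ≫ (f + g) = 𝟙 Y + section_ f ≫ g := by simp
  rw [Category.assoc, this, IsIso.inv_hom_id]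

end IsRadicalMor

end Radical

/-! ### Morphisms of modules over the repetitive algebra and their components -/

namespace RepMod

section Basic

variable {k Λ : Type u} [Field k] [Ring Λ] [Algebra k Λ] {M N : RepMod k Λ}

theorem app_isSplitMono (f : M ⟶ N) [IsSplitMono f] (i : ℤ) : IsSplitMono (f.app i) :=
  IsSplitMono.mk' ⟨Hom.app (retraction f) i, by rw [← comp_app, IsSplitMono.id, id_app]⟩

theorem app_isSplitEpi (f : M ⟶ N) [IsSplitEpi f] (i : ℤ) : IsSplitEpi (f.app i) :=
  IsSplitEpi.mk' ⟨Hom.app (section_ f) i, by rw [← comp_app, IsSplitEpi.id, id_app]⟩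

theorem app_isIso (f : M ⟶ N) (_ : IsIso f) (i : ℤ) : IsIso (f.app i) :=
  ⟨Hom.app (inv f) i, by rw [← comp_app, IsIso.hom_inv_id, id_app],
    by rw [← comp_app, IsIso.inv_hom_id, id_app]⟩

theorem comp_app_apply {P : RepMod k Λ} (f : M ⟶ N) (g : N ⟶ P) (i : ℤ) (m : M.obj i) :
    (Hom.app (f ≫ g) i).hom.hom m = (g.app i).hom.hom ((f.app i).hom.hom m) := rfl

/-- A morphism with bijective components is an isomorphism. -/
theorem isIso_of_bijective (f : M ⟶ N) (h : ∀ i, Function.Bijective (f.app i).hom.hom) :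
    IsIso f := by
  let e i : M.obj i ≃ₗ[Λ] N.obj i := LinearEquiv.ofBijective (f.app i).hom.hom (h i)
  let g : N ⟶ M :=
    { app := fun i => FGModuleCat.ofHom (e i).symm.toLinearMap
      comm := fun i φ m => by
        change (e (i + 1)).symm (N.act i φ m) = M.act i φ ((e i).symm m)
        rw [LinearEquiv.symm_apply_eq]
        refine Eq.trans ?_ (f.comm i φ _).symm
        exact congrArg (N.act i φ) ((e i).apply_symm_apply m).symm }
  refine ⟨g, hom_ext fun i => FGModuleCat.hom_ext (LinearMap.ext fun x => ?_),
    hom_ext fun i => FGModuleCat.hom_ext (LinearMap.ext fun x => ?_)⟩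
  · exact (e i).symm_apply_apply x
  · exact (e i).apply_symm_apply x

/-- A morphism with surjective components is an epimorphism. -/
theorem epi_of_surjective (f : M ⟶ N) (h : ∀ i, Function.Surjective (f.app i).hom.hom) :
    Epi f := by
  refine ⟨fun {Z} a b hab => hom_ext fun i => FGModuleCat.hom_ext (LinearMap.ext fun x => ?_)⟩
  obtain ⟨y, rfl⟩ := h i x
  rw [← comp_app_apply, hab, comp_app_apply]

theorem injective_of_isSplitMono {X Y : FGModuleCat.{u} Λ} {f : X ⟶ Y} (h : IsSplitMono f) :
    Function.Injective f.hom.hom := fun x y hxy => by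
  have h₁ (z : X) : (retraction f).hom.hom (f.hom.hom z) = z :=
    congrArg (fun g : X ⟶ X => g.hom.hom z) (IsSplitMono.id f)
  rw [← h₁ x, ← h₁ y, hxy]

theorem surjective_of_isSplitEpi {X Y : FGModuleCat.{u} Λ} {f : X ⟶ Y} (h : IsSplitEpi f) :
    Function.Surjective f.hom.hom := fun y =>
  ⟨(section_ f).hom.hom y, congrArg (fun g : Y ⟶ Y => g.hom.hom y) (IsSplitEpi.id f)⟩

theorem isSplitMono_of_isSplitEpi_of_injective {X Y : FGModuleCat.{u} Λ} {f : X ⟶ Y}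
    (h : IsSplitEpi f) (hf : Function.Injective f.hom.hom) : IsSplitMono f := by
  refine IsSplitMono.mk' ⟨section_ f, FGModuleCat.hom_ext (LinearMap.ext fun x => hf ?_)⟩
  exact congrArg (fun g : Y ⟶ Y => g.hom.hom (f.hom.hom x)) (IsSplitEpi.id f)

theorem isSplitEpi_of_isSplitMono_of_surjective {X Y : FGModuleCat.{u} Λ} {f : X ⟶ Y}
    (h : IsSplitMono f) (hf : Function.Surjective f.hom.hom) : IsSplitEpi f := by
  refine IsSplitEpi.mk' ⟨retraction f, FGModuleCat.hom_ext (LinearMap.ext fun y => ?_)⟩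
  obtain ⟨x, rfl⟩ := hf y
  exact congrArg (fun g : X ⟶ X => f.hom.hom (g.hom.hom x)) (IsSplitMono.id f)

/-- The image of a morphism of modules over the repetitive algebra, formed componentwise. -/
def image [IsNoetherianRing Λ] (f : M ⟶ N) : RepMod k Λ where
  obj i := FGModuleCat.of Λ (LinearMap.range (f.app i).hom.hom)
  finite_support := by
    refine N.finite_support.subset fun i hi => ?_
    have : Nontrivial (LinearMap.range (f.app i).hom.hom) := hi
    exact (Subtype.val_injective (p := (· ∈ LinearMap.range (f.app i).hom.hom))).nontrivial
  act i :=
    { toFun := fun φ => AddMonoidHom.codRestrict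
        ((N.act i φ).comp (LinearMap.range (f.app i).hom.hom).subtype.toAddMonoidHom)
        (LinearMap.range (f.app (i + 1)).hom.hom) <| by
          rintro ⟨_, m, rfl⟩
          exact ⟨M.act i φ m, f.comm i φ m⟩
      map_zero' := by
        ext x
        exact DFunLike.congr_fun (map_zero (N.act i)) x.1
      map_add' := fun φ ψ => by
        ext x
        exact DFunLike.congr_fun (map_add (N.act i) φ ψ) x.1 }
  act_balanced i φ a m := Subtype.ext (N.act_balanced i φ a m.1)
  act_smul i a φ m := Subtype.ext (N.act_smul i a φ m.1)
  act_act i φ ψ m := Subtype.ext (N.act_act i φ ψ m.1)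

/-- The corestriction of a morphism to its image. -/
def toImage [IsNoetherianRing Λ] (f : M ⟶ N) : M ⟶ image f where
  app i := FGModuleCat.ofHom (LinearMap.rangeRestrict (f.app i).hom.hom)
  comm i φ m := Subtype.ext (f.comm i φ m)

/-- The inclusion of the image of a morphism. -/
def imageι [IsNoetherianRing Λ] (f : M ⟶ N) : image f ⟶ N where
  app i := FGModuleCat.ofHom (LinearMap.range (f.app i).hom.hom).subtype
  comm _ _ _ := rfl

theorem toImage_comp_imageι [IsNoetherianRing Λ] (f : M ⟶ N) : toImage f ≫ imageι f = f := rfl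

/-- An irreducible morphism is injective in all degrees or surjective in all degrees, because it
factors through its image. -/
theorem injective_or_surjective_of_irreducible [IsNoetherianRing Λ] {f : M ⟶ N}
    (hf : IsIrreducibleMor f) :
    (∀ i, Function.Injective (f.app i).hom.hom) ∨
      ∀ i, Function.Surjective (f.app i).hom.hom := by
  rcases hf.2.2 _ _ (toImage_comp_imageι f) with h | h
  · refine Or.inl fun i x y hxy => injective_of_isSplitMono (app_isSplitMono (toImage f) i) ?_
    exact Subtype.ext hxy
  · refine Or.inr fun i y => ?_
    obtain ⟨x, rfl⟩ := surjective_of_isSplitEpi (app_isSplitEpi (imageι f) i) y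
    exact x.2

end Basic

end RepMod

/-! ### Fitting's lemma and modules without projective summands -/

namespace RepMod

section Fitting

variable {k Λ : Type u} [Field k] [Ring Λ] [Algebra k Λ] {M N : RepMod k Λ}

theorem app_pow_apply (b : End M) (n : ℕ) (i : ℤ) (x : M.obj i) :
    (Hom.app (b ^ n : End M) i).hom.hom x = ((Hom.app b i).hom.hom ^ n) x := by
  induction n generalizing x with
  | zero => rfl
  | succ n ih =>
    rw [pow_succ, pow_succ]
    exact ih _

/-- Fitting's lemma: a high power of an endomorphism `b` splits every component into the kernel
and the range of that power. The exponent is uniform in the degree since almost all components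
vanish. -/
theorem exists_isCompl_ker_range_pow [IsArtinianRing Λ] (b : End M) :
    ∃ n : ℕ, n ≠ 0 ∧ ∀ i, IsCompl (LinearMap.ker (Hom.app (b ^ n : End M) i).hom.hom)
      (LinearMap.range (Hom.app (b ^ n : End M) i).hom.hom) := by
  have h (i : ℤ) := ((Hom.app b i).hom.hom).eventually_isCompl_ker_pow_range_pow
  obtain ⟨n, hn, hn₀⟩ := ((M.finite_support.eventually_all).2 fun i _ => h i).and
    (Filter.eventually_ne_atTop 0) |>.exists
  refine ⟨n, hn₀, fun i => ?_⟩
  have e : (Hom.app (b ^ n : End M) i).hom.hom = (Hom.app b i).hom.hom ^ n :=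
    LinearMap.ext fun x => app_pow_apply b n i x
  rw [e]
  by_cases hi : Nontrivial (M.obj i)
  · exact hn i hi
  · rw [not_nontrivial_iff_subsingleton] at hi
    have : Subsingleton (Submodule Λ (M.obj i)) := inferInstance
    exact ⟨disjoint_iff.2 (Subsingleton.elim _ _), codisjoint_iff.2 (Subsingleton.elim _ _)⟩

/-- The projection onto the kernel of an endomorphism along its range. -/
def kerProj (b : M ⟶ M) (h : ∀ i, IsCompl (LinearMap.ker (b.app i).hom.hom)
    (LinearMap.range (b.app i).hom.hom)) : M ⟶ M where
  app i := FGModuleCat.ofHom (Submodule.projection _ _ (h i))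
  comm i φ m := by
    obtain ⟨x, hx, _, ⟨y, rfl⟩, rfl⟩ : ∃ x ∈ LinearMap.ker (b.app i).hom.hom,
        ∃ y ∈ LinearMap.range (b.app i).hom.hom, x + y = m := by
      rw [← Submodule.mem_sup, (h i).sup_eq_top]
      trivial
    have hx' : M.act i φ x ∈ LinearMap.ker (b.app (i + 1)).hom.hom := by
      rw [LinearMap.mem_ker] at hx ⊢
      rw [b.comm, hx, map_zero]
    have e₁ : Submodule.projection _ _ (h i) (x + (b.app i).hom.hom y) = x := by
      rw [map_add, Submodule.projection_apply_of_mem_left _ hx,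
        (Submodule.projection_apply_eq_zero_iff _).2 (LinearMap.mem_range_self _ y), add_zero]
    have e₂ : Submodule.projection _ _ (h (i + 1))
        (M.act i φ x + (b.app (i + 1)).hom.hom (M.act i φ y)) = M.act i φ x := by
      rw [map_add, Submodule.projection_apply_of_mem_left _ hx',
        (Submodule.projection_apply_eq_zero_iff _).2 (LinearMap.mem_range_self _ _), add_zero]
    have e₃ : M.act i φ (x + (b.app i).hom.hom y) =
        M.act i φ x + (b.app (i + 1)).hom.hom (M.act i φ y) := by
      rw [map_add, b.comm]
    change Submodule.projection _ _ (h (i + 1)) (M.act i φ (x + (b.app i).hom.hom y)) =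
      M.act i φ (Submodule.projection _ _ (h i) (x + (b.app i).hom.hom y))
    rw [e₁, e₃, e₂]

/-- If `M` has no projective summands, an endomorphism of `M` that factors through a projective
lies in the radical of the endomorphism ring. By Fitting's lemma some power `(𝟙 + u ≫ v) ^ n`
splits off its kernel. On that kernel the identity is a multiple of `u ≫ v`, so it is a projective
summand and vanishes. -/
theorem NoProjectiveSummand.isIso_id_add [IsArtinianRing Λ] (hM : M.NoProjectiveSummand)
    {P : RepMod k Λ} (hP : Projective P) (u : M ⟶ P) (v : P ⟶ M) : IsIso (𝟙 M + u ≫ v) := by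
  let a : End M := 𝟙 M + u ≫ v
  obtain ⟨n, hn₀, hn⟩ := exists_isCompl_ker_range_pow a
  have hpow (m : ℕ) : ∃ c : P ⟶ M, (a ^ m : End M) = 𝟙 M + u ≫ c := by
    induction m with
    | zero => exact ⟨0, by rw [comp_zero, add_zero, pow_zero]; rfl⟩
    | succ m ih =>
      obtain ⟨c, hc⟩ := ih
      refine ⟨c + v + v ≫ u ≫ c, ?_⟩
      rw [pow_succ, hc]
      change (𝟙 M + u ≫ v) ≫ (𝟙 M + u ≫ c) = _
      simp only [Preadditive.comp_add, Preadditive.add_comp, Category.id_comp, Category.comp_id,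
        Category.assoc]
      abel
  obtain ⟨c, hc⟩ := hpow n
  let p := kerProj (a ^ n : End M) hn
  have hp : p ≫ (𝟙 M + u ≫ c) = 0 := by
    rw [← hc]
    refine hom_ext fun i => FGModuleCat.hom_ext (LinearMap.ext fun x => ?_)
    exact LinearMap.mem_ker.1 (Submodule.projection_apply_mem (hn i) x)
  have hι : imageι p ≫ p = imageι p := by
    refine hom_ext fun i => FGModuleCat.hom_ext (LinearMap.ext fun x => ?_)
    obtain ⟨_, y, rfl⟩ := x
    exact Submodule.projection_apply_of_mem_left (hn i)
      (Submodule.projection_apply_mem (hn i) y)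
  have hretract : imageι p ≫ toImage p = 𝟙 (image p) := by
    refine hom_ext fun i => FGModuleCat.hom_ext (LinearMap.ext fun x => Subtype.ext ?_)
    exact congrArg (fun g : image p ⟶ M => (g.app i).hom.hom x) hι
  have hfactor : imageι p ≫ u ≫ c = - imageι p := by
    have : imageι p ≫ (𝟙 M + u ≫ c) = 0 := by
      rw [← hι, Category.assoc, hp, comp_zero]
    rw [Preadditive.comp_add, Category.comp_id, add_comm] at this
    exact eq_neg_of_add_eq_zero_left this
  have hproj : Projective (image p) := by
    refine Retract.projective (Y := P) ⟨imageι p ≫ u, - (c ≫ toImage p), ?_⟩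
    rw [Preadditive.comp_neg, Category.assoc, ← Category.assoc u c, ← Category.assoc (imageι p),
      hfactor, Preadditive.neg_comp, neg_neg, hretract]
  have hzero := hM _ hproj ⟨⟨imageι p, toImage p, hretract⟩⟩
  have hker (i : ℤ) : LinearMap.ker (Hom.app (a ^ n : End M) i).hom.hom = ⊥ := by
    have h₀ : p = 0 := by
      rw [← toImage_comp_imageι p, hzero.eq_of_src (imageι p) 0, comp_zero]
    refine (Submodule.eq_bot_iff _).2 fun x hx => ?_
    rw [← Submodule.projection_apply_of_mem_left (hn i) hx]
    exact congrArg (fun g : M ⟶ M => (g.app i).hom.hom x) h₀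
  refine isIso_of_bijective _ fun i => ?_
  have hinj : Function.Injective (Hom.app a i).hom.hom := by
    rw [injective_iff_map_eq_zero]
    intro x hx
    obtain ⟨m, rfl⟩ := Nat.exists_eq_succ_of_ne_zero hn₀
    have hx' : x ∈ LinearMap.ker (Hom.app (a ^ (m + 1) : End M) i).hom.hom := by
      rw [LinearMap.mem_ker, app_pow_apply, pow_succ, Module.End.mul_apply]
      exact (congrArg _ hx).trans (map_zero _)
    rw [hker, Submodule.mem_bot] at hx'
    exact hx'
  exact IsArtinian.bijective_of_injective_endomorphism _ hinj

end Fitting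

end RepMod

/-! ### The bimodule `Q` and free modules over the repetitive algebra -/

section DualModule

variable (k Λ : Type u) [Field k] [Ring Λ] [Algebra k Λ]

/-- The left `Λ`-module underlying the bimodule `Q = Hom_k (Λ, k)`. A type synonym keeps its
action `(a φ) x = φ (x a)` apart from the actions that Mathlib puts on `Module.Dual k Λ`. -/
def DualModule : Type u := Module.Dual k Λ

instance : AddCommGroup (DualModule k Λ) := inferInstanceAs (AddCommGroup (Module.Dual k Λ))

instance : Module k (DualModule k Λ) := inferInstanceAs (Module k (Module.Dual k Λ))

instance : Module Λ (DualModule k Λ) where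
  smul a φ := dualLeft k Λ a φ
  one_smul φ := LinearMap.ext fun x => congrArg (show Module.Dual k Λ from φ) (mul_one x)
  mul_smul a b φ :=
    LinearMap.ext fun x => congrArg (show Module.Dual k Λ from φ) (mul_assoc x a b).symm
  smul_zero _ := rfl
  smul_add _ _ _ := rfl
  add_smul a b φ := LinearMap.ext fun x =>
    (congrArg (show Module.Dual k Λ from φ) (mul_add x a b)).trans
      (map_add (show Module.Dual k Λ from φ) _ _)
  zero_smul φ := LinearMap.ext fun x =>
    (congrArg (show Module.Dual k Λ from φ) (mul_zero x)).trans
      (map_zero (show Module.Dual k Λ from φ))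

instance : IsScalarTower k Λ (DualModule k Λ) where
  smul_assoc c a φ := LinearMap.ext fun x =>
    (congrArg (show Module.Dual k Λ from φ) (mul_smul_comm c x a)).trans
      (map_smul (show Module.Dual k Λ from φ) c (x * a))

instance [FiniteDimensional k Λ] : Module.Finite Λ (DualModule k Λ) := by
  have : Module.Finite k (DualModule k Λ) := inferInstanceAs (Module.Finite k (Module.Dual k Λ))
  exact Module.Finite.of_restrictScalars_finite k Λ _

variable {Λ} in
/-- Evaluation of the functionals in `Q` at an element of `Λ`. -/
def DualModule.eval (a : Λ) : DualModule k Λ →ₗ[k] k :=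
  LinearMap.applyₗ (R := k) (M := Λ) (M₂ := k) a

/-- The right action of `Λ` on `Q`, as a biadditive map. -/
def dualRightHom : Module.Dual k Λ →+ Λ →+ DualModule k Λ :=
  AddMonoidHom.mk' (fun φ => AddMonoidHom.mk' (fun a => dualRight k Λ φ a) fun a b =>
      LinearMap.ext fun x => (congrArg φ (add_mul a b x)).trans (map_add φ _ _)) fun _ _ => rfl

variable {k Λ}

theorem dualRight_mul (φ : Module.Dual k Λ) (a b : Λ) :
    dualRight k Λ (dualRight k Λ φ a) b = dualRight k Λ φ (a * b) :=
  LinearMap.ext fun x => congrArg φ (mul_assoc a b x).symm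

theorem dualRight_dualLeft (a : Λ) (φ : Module.Dual k Λ) (b : Λ) :
    dualRight k Λ (dualLeft k Λ a φ) b = dualLeft k Λ a (dualRight k Λ φ b) :=
  LinearMap.ext fun x => congrArg φ (mul_assoc b x a)

end DualModule

namespace RepMod

section Transport

variable {k Λ : Type u} [Field k] [Ring Λ] [Algebra k Λ] {M : RepMod k Λ}
variable {T : Type} {d : T → ℤ}

/-- The component `Q × M j → M i` of the structure map for `j + 1 = i`. -/
def actTo (M : RepMod k Λ) {j i : ℤ} (h : j + 1 = i) (φ : Module.Dual k Λ) :
    M.obj j →+ M.obj i :=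
  h ▸ M.act j φ

/-- The transport to degree `i` of the member `x t` of a family, for `d t = i`. -/
def famTo {M : RepMod k Λ} (x : ∀ t, M.obj (d t)) {i : ℤ} (t : {t // d t = i}) : M.obj i :=
  t.2 ▸ x t.1

theorem actTo_add {j i : ℤ} (h : j + 1 = i) (φ ψ : Module.Dual k Λ) (m : M.obj j) :
    M.actTo h (φ + ψ) m = M.actTo h φ m + M.actTo h ψ m := by
  subst h
  exact DFunLike.congr_fun (map_add (M.act j) φ ψ) m

theorem actTo_dualLeft {j i : ℤ} (h : j + 1 = i) (a : Λ) (φ : Module.Dual k Λ) (m : M.obj j) :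
    M.actTo h (dualLeft k Λ a φ) m = a • M.actTo h φ m := by
  subst h
  exact M.act_smul j a φ m

theorem act_actTo {j i : ℤ} (h : j + 1 = i) (φ ψ : Module.Dual k Λ) (m : M.obj j) :
    M.act i φ (M.actTo h ψ m) = 0 := by
  subst h
  exact M.act_act j φ ψ m

theorem actTo_dualRight {i : ℤ} (x : ∀ t, M.obj (d t)) (φ : Module.Dual k Λ) (a : Λ)
    (t : {t // d t + 1 = i + 1}) :
    M.actTo t.2 (dualRight k Λ φ a) (x t.1) =
      M.act i φ (a • famTo x ⟨t.1, add_right_cancel t.2⟩) := by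
  obtain ⟨t, ht⟩ := t
  obtain rfl : d t = i := add_right_cancel ht
  exact M.act_balanced _ φ a _

end Transport

section Free

variable {k Λ : Type u} [Field k] [Ring Λ] [Algebra k Λ] [FiniteDimensional k Λ]
variable {T : Type} [Fintype T] (d : T → ℤ)

variable (k Λ) in
/-- The structure map of a free module, which multiplies the copies of `Λ` into those of `Q`. -/
def freeAct (i : ℤ) : Module.Dual k Λ →+
    (({t // d t = i} → Λ) × ({t // d t + 1 = i} → DualModule k Λ)) →+
      (({t // d t = i + 1} → Λ) × ({t // d t + 1 = i + 1} → DualModule k Λ)) :=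
  AddMonoidHom.mk' (fun φ => AddMonoidHom.mk'
      (fun x => (0, fun t => dualRightHom k Λ φ (x.1 ⟨t.1, add_right_cancel t.2⟩)))
      fun x y => Prod.ext (add_zero _).symm
        (funext fun t => map_add (dualRightHom k Λ φ) _ _))
    fun φ ψ => by
      ext1 x
      exact Prod.ext (add_zero _).symm
        (funext fun t => DFunLike.congr_fun (map_add (dualRightHom k Λ) φ ψ) _)

variable (k Λ) in
/-- The free module over the repetitive algebra on generators `t : T` of degree `d t`. A generator
contributes a copy of `Λ` in its own degree and a copy of `Q` in the following degree. Indexing by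
subtypes of `T` lets a generator be moved along an equality of degrees without a cast. -/
def free : RepMod k Λ where
  obj i := FGModuleCat.of Λ (({t // d t = i} → Λ) × ({t // d t + 1 = i} → DualModule k Λ))
  finite_support := by
    refine ((Set.finite_range d).union (Set.finite_range fun t => d t + 1)).subset fun i hi => ?_
    by_contra hc
    have h₁ : IsEmpty {t // d t = i} := ⟨fun t => hc (Or.inl ⟨t, t.2⟩)⟩
    have h₂ : IsEmpty {t // d t + 1 = i} := ⟨fun t => hc (Or.inr ⟨t, t.2⟩)⟩
    have : Subsingleton (({t // d t = i} → Λ) × ({t // d t + 1 = i} → DualModule k Λ)) :=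
      inferInstance
    exact not_nontrivial _ hi
  act := freeAct k Λ d
  act_balanced i φ a x := Prod.ext rfl (funext fun t => dualRight_mul φ a _)
  act_smul i a φ x := Prod.ext (smul_zero a).symm (funext fun t => dualRight_dualLeft a φ _)
  act_act i φ ψ x := Prod.ext rfl (funext fun t => map_zero (dualRightHom k Λ φ))

variable {d} {M : RepMod k Λ}

/-- The components of the morphism `desc`. -/
def descApp (x : ∀ t, M.obj (d t)) (i : ℤ) :
    (({t // d t = i} → Λ) × ({t // d t + 1 = i} → DualModule k Λ)) →ₗ[Λ] M.obj i where
  toFun y := ∑ t, y.1 t • famTo x t + ∑ t : {t // d t + 1 = i}, M.actTo t.2 (y.2 t) (x t.1)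
  map_add' y z := by
    have h (t : {t // d t + 1 = i}) : M.actTo t.2 ((y + z).2 t) (x t.1) =
        M.actTo t.2 (y.2 t) (x t.1) + M.actTo t.2 (z.2 t) (x t.1) := actTo_add _ _ _ _
    simp only [h, Finset.sum_add_distrib, Prod.fst_add, Pi.add_apply, add_smul]
    abel
  map_smul' a y := by
    have h (t : {t // d t + 1 = i}) : M.actTo t.2 ((a • y).2 t) (x t.1) =
        a • M.actTo t.2 (y.2 t) (x t.1) := actTo_dualLeft _ _ _ _
    simp only [h, Prod.smul_fst, Pi.smul_apply, smul_eq_mul, mul_smul, RingHom.id_apply,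
      smul_add, Finset.smul_sum]

/-- The morphism out of the free module that sends the generators to a given family. -/
def desc (x : ∀ t, M.obj (d t)) : free k Λ d ⟶ M where
  app i := FGModuleCat.ofHom (descApp x i)
  comm i φ y := by
    obtain ⟨y₁, y₂⟩ := y
    change ∑ t : {t // d t = i + 1}, (0 : Λ) • famTo x t + ∑ t : {t // d t + 1 = i + 1},
        M.actTo t.2 (dualRight k Λ φ (y₁ ⟨t.1, add_right_cancel t.2⟩)) (x t.1) =
      M.act i φ (∑ t, y₁ t • famTo x t + ∑ t : {t // d t + 1 = i}, M.actTo t.2 (y₂ t) (x t.1))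
    have h : ∑ t : {t // d t + 1 = i}, M.act i φ (M.actTo t.2 (y₂ t) (x t.1)) = 0 :=
      Finset.sum_eq_zero fun t _ => act_actTo t.2 φ _ _
    simp only [zero_smul, Finset.sum_const_zero, zero_add, map_add, map_sum, actTo_dualRight]
    refine Eq.trans ?_ ((congrArg (_ + ·) h).trans (add_zero _)).symm
    exact Fintype.sum_equiv (Equiv.subtypeEquivRight (p := fun t => d t + 1 = i + 1)
      (q := fun t => d t = i) fun t => add_left_inj 1) _ _ fun t => rfl

theorem desc_app_single [DecidableEq T] (x : ∀ t, M.obj (d t)) (t : T) :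
    ((desc x).app (d t)).hom.hom (Pi.single ⟨t, rfl⟩ 1, 0) = x t := by
  change ∑ s : {s // d s = d t}, (Pi.single ⟨t, rfl⟩ 1 : {s // d s = d t} → Λ) s • famTo x s +
    ∑ s : {s // d s + 1 = d t}, M.actTo s.2 0 (x s.1) = x t
  have h (s : {s // d s + 1 = d t}) : M.actTo s.2 0 (x s.1) = 0 := by
    simpa using actTo_add s.2 0 0 (x s.1)
  rw [Finset.sum_eq_single ⟨t, rfl⟩ (fun s _ hs => by rw [Pi.single_eq_of_ne hs, zero_smul])
    (fun hs => absurd (Finset.mem_univ _) hs), Pi.single_eq_same, one_smul]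
  simp only [h, Finset.sum_const_zero, add_zero]
  rfl

/-- Every module over the repetitive algebra is a quotient of a free one. -/
theorem exists_free_surjective (M : RepMod k Λ) :
    ∃ (T : Type) (_ : Fintype T) (d : T → ℤ) (f : free k Λ d ⟶ M),
      ∀ i, Function.Surjective (f.app i).hom.hom := by
  classical
  have := M.finite_support.fintype
  choose n p hp using fun i => Module.Finite.exists_fin' Λ (M.obj i)
  let T := Σ i : {i : ℤ | Nontrivial (M.obj i)}, Fin (n i)
  let d : T → ℤ := fun t => t.1
  let x : ∀ t : T, M.obj (d t) := fun t => p t.1 (Pi.single t.2 1)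
  refine ⟨T, inferInstance, d, desc x, fun i y => ?_⟩
  by_cases hi : Nontrivial (M.obj i)
  · obtain ⟨c, rfl⟩ := hp i y
    rw [← LinearMap.mem_range, pi_eq_sum_univ' c, map_sum]
    refine Submodule.sum_mem _ fun s _ => ?_
    rw [map_smul]
    refine Submodule.smul_mem _ _ ?_
    have e : (fun j => if s = j then (1 : Λ) else 0) = Pi.single s 1 := by
      ext j
      simp [Pi.single_apply, eq_comm]
    have h := desc_app_single x ⟨⟨i, hi⟩, s⟩
    have h' : x ⟨⟨i, hi⟩, s⟩ = p i (Pi.single s 1) := rfl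
    first | rw [e, ← h'] | rw [← h']
    exact ⟨_, h⟩
  · rw [not_nontrivial_iff_subsingleton] at hi
    exact ⟨0, Subsingleton.elim _ _⟩

/-- A `Λ`-linear map from the generators in degree `i` extends to the free module so as to vanish
on the copies of `Q` in degree `i`. -/
theorem exists_free_desc (i : ℤ) (s : ({t // d t = i} → Λ) →ₗ[Λ] M.obj i) :
    ∃ f : free k Λ d ⟶ M, ∀ y, (f.app i).hom.hom y = s y.1 := by
  classical
  let σ : ∀ j, ({t // d t = j} → Λ) →ₗ[Λ] M.obj j := Function.update (fun _ => 0) i s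
  have hσ : σ i = s := Function.update_self ..
  let x : ∀ t, M.obj (d t) := fun t => σ (d t) (Pi.single ⟨t, rfl⟩ 1)
  have hx {j : ℤ} (t : {t // d t = j}) : famTo x t = σ j (Pi.single t 1) := by
    obtain ⟨t, rfl⟩ := t
    rfl
  refine ⟨desc x, fun y => ?_⟩
  obtain ⟨y, z⟩ := y
  change ∑ t, y t • famTo x t + ∑ t : {t // d t + 1 = i}, M.actTo t.2 (z t) (x t.1) = s y
  have h (t : {t // d t + 1 = i}) : M.actTo t.2 (z t) (x t.1) = 0 := by
    have h₀ : σ (d t) = 0 := Function.update_of_ne (by have := t.2; omega) ..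
    have h₁ : x t.1 = 0 := by
      change σ (d t) _ = 0
      rw [h₀, LinearMap.zero_apply]
    rw [h₁, map_zero]
  simp only [h, hx, hσ, Finset.sum_const_zero, add_zero, ← map_smul, ← map_sum]
  congr 1
  ext t
  simp [Pi.single_apply]

/-- Every endomorphism of the left module `Q` is a right multiplication. In particular, for a
`Λ`-linear map `θ : N (j + 1) → Q` and `x : N j`, the endomorphism `φ ↦ θ (φ x)` of `Q` is right
multiplication by an element `c x` of `Λ`. -/
theorem exists_coeff (N : RepMod k Λ) (j : ℤ) (θ : N.obj (j + 1) →ₗ[Λ] DualModule k Λ) :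
    ∃ c : N.obj j →ₗ[Λ] Λ, ∀ (φ : Module.Dual k Λ) (x : N.obj j),
      dualRight k Λ φ (c x) = θ (N.act j φ x) := by
  have hsmul (a : k) (φ : Module.Dual k Λ) (x : N.obj j) :
      θ (N.act j (a • φ) x) = a • θ (N.act j φ x) := by
    have h : a • φ = dualLeft k Λ (algebraMap k Λ a) φ := LinearMap.ext fun y => by
      change a • φ y = φ (y * algebraMap k Λ a)
      rw [← map_smul, Algebra.smul_def, Algebra.commutes]
    rw [h, N.act_smul, map_smul, algebraMap_smul]
  let E (x : N.obj j) : Module.Dual k (Module.Dual k Λ) :=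
    { toFun := fun φ => DualModule.eval k 1 (θ (N.act j φ x))
      map_add' := fun φ ψ => by
        have : θ (N.act j (φ + ψ) x) = θ (N.act j φ x) + θ (N.act j ψ x) := by
          rw [map_add, AddMonoidHom.add_apply, map_add]
        exact (congrArg (DualModule.eval k 1) this).trans (map_add _ _ _)
      map_smul' := fun a φ => (congrArg (DualModule.eval k 1) (hsmul a φ x)).trans (map_smul _ _ _) }
  let c₀ (x : N.obj j) : Λ := (Module.evalEquiv k Λ).symm (E x)
  have hc₀ (φ : Module.Dual k Λ) (x : N.obj j) :
      φ (c₀ x) = DualModule.eval k 1 (θ (N.act j φ x)) :=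
    Module.apply_evalEquiv_symm_apply k Λ φ (E x)
  have hext {a b : Λ} (h : ∀ φ : Module.Dual k Λ, φ a = φ b) : a = b :=
    (Module.evalEquiv k Λ).injective (LinearMap.ext h)
  refine ⟨{ toFun := c₀, map_add' := fun x y => hext fun φ => ?_,
            map_smul' := fun a x => hext fun φ => ?_ }, fun φ x => LinearMap.ext fun a => ?_⟩
  · rw [map_add, hc₀, hc₀, hc₀, map_add, map_add]
    rfl
  · rw [hc₀, ← N.act_balanced, ← hc₀]
    rfl
  · have h : θ (N.act j (dualLeft k Λ a φ) x) = a • θ (N.act j φ x) := by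
      rw [N.act_smul, map_smul]
    change φ (c₀ x * a) = DualModule.eval k a (θ (N.act j φ x))
    have h' := congrArg (DualModule.eval k 1) h
    refine (hc₀ (dualLeft k Λ a φ) x).trans (h'.trans ?_)
    exact congrArg (fun b => DualModule.eval k b (θ (N.act j φ x))) (one_mul a)

theorem eq_zero_of_dualRight {a : Λ} (h : ∀ φ, dualRight k Λ φ a = 0) : a = 0 := by
  refine (Module.forall_dual_apply_eq_zero_iff k a).1 fun φ => ?_
  rw [← mul_one a]
  exact congrArg (fun χ : Module.Dual k Λ => χ 1) (h φ)

/-- A `Λ`-linear map to the copies of `Q` in degree `i` of a free module lifts to a morphism to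
the free module that vanishes into the copies of `Λ` in degree `i`. -/
theorem exists_free_lift {N : RepMod k Λ} (i : ℤ)
    (s : N.obj i →ₗ[Λ] ({t // d t + 1 = i} → DualModule k Λ)) :
    ∃ f : N ⟶ free k Λ d, ∀ y, (f.app i).hom.hom y = (0, s y) := by
  classical
  let σ : ∀ j, N.obj j →ₗ[Λ] ({t // d t + 1 = j} → DualModule k Λ) :=
    Function.update (fun _ => 0) i s
  have hσ : σ i = s := Function.update_self ..
  have hσ' : σ (i + 1) = 0 := Function.update_of_ne (by omega) ..
  choose c hc using fun (j : ℤ) (t : {t // d t = j}) =>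
    exists_coeff N j (LinearMap.proj ⟨t.1, by rw [t.2]⟩ ∘ₗ σ (j + 1))
  let f : N ⟶ free k Λ d :=
    { app := fun j => FGModuleCat.ofHom ((LinearMap.pi (c j)).prod (σ j))
      comm := fun j φ x => by
        refine Prod.ext (funext fun t => ?_) (funext fun t => ?_)
        · refine eq_zero_of_dualRight (k := k) fun ψ => (hc _ t ψ _).trans ?_
          rw [N.act_act, map_zero]
          rfl
        · exact (hc j ⟨t.1, add_right_cancel t.2⟩ φ x).symm }
  refine ⟨f, fun y => Prod.ext (funext fun t => ?_) ?_⟩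
  · refine eq_zero_of_dualRight (k := k) fun ψ => (hc i t ψ y).trans ?_
    rw [hσ']
    rfl
  · change σ i y = s y
    rw [hσ]

end Free

end RepMod

/-! ### Radical components of morphisms that factor through projectives -/

namespace RepMod

section RadicalComponents

variable {k Λ : Type u} [Field k] [Ring Λ] [Algebra k Λ] [FiniteDimensional k Λ]
variable {M N : RepMod k Λ}

/-- Between modules without projective summands, a morphism that factors through a projective has
radical components. In degree `i` a free module is the sum of copies of `Λ` generated in degree `i`
and of copies of `Q` cogenerated there. A map from the former to `M i` and a map from `N i` to the
latter extend over the repetitive algebra, so both corners are controlled by endomorphisms of `M`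
and of `N` that factor through the projective. -/
theorem isRadicalMor_app_of_projective (hM : M.NoProjectiveSummand) (hN : N.NoProjectiveSummand)
    {P : RepMod k Λ} (hP : Projective P) (u : M ⟶ P) (v : P ⟶ N) (i : ℤ) :
    IsRadicalMor (Hom.app (u ≫ v) i) := by
  have : IsArtinianRing Λ := IsArtinianRing.of_finite k Λ
  obtain ⟨T, _, d, r, hr⟩ := exists_free_surjective P
  have := epi_of_surjective r hr
  obtain ⟨j, hj⟩ : ∃ j, j ≫ r = 𝟙 P := ⟨_, Projective.factorThru_comp (𝟙 P) r⟩
  let F := FGModuleCat.of Λ ({t // d t = i} → Λ)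
  let Q := FGModuleCat.of Λ ({t // d t + 1 = i} → DualModule k Λ)
  let p₁ : (free k Λ d).obj i ⟶ F := FGModuleCat.ofHom (LinearMap.fst Λ _ _)
  let p₂ : (free k Λ d).obj i ⟶ Q := FGModuleCat.ofHom (LinearMap.snd Λ _ _)
  let i₁ : F ⟶ (free k Λ d).obj i := FGModuleCat.ofHom (LinearMap.inl Λ _ _)
  let i₂ : Q ⟶ (free k Λ d).obj i := FGModuleCat.ofHom (LinearMap.inr Λ _ _)
  have hsum : p₁ ≫ i₁ + p₂ ≫ i₂ = 𝟙 _ :=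
    FGModuleCat.hom_ext (LinearMap.ext fun x => Prod.ext (add_zero _) (zero_add _))
  have h₁ : IsRadicalMor (Hom.app (u ≫ j) i ≫ p₁) := fun s => by
    obtain ⟨f, hf⟩ := exists_free_desc i s.hom.hom
    have hf' : f.app i = p₁ ≫ s := FGModuleCat.hom_ext (LinearMap.ext hf)
    have h := app_isIso _ (hM.isIso_id_add hP u (j ≫ f)) i
    rw [add_app, id_app, ← Category.assoc, comp_app _ f, hf'] at h
    rwa [Category.assoc]
  have h₂ : IsRadicalMor (i₂ ≫ Hom.app (r ≫ v) i) := fun s => by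
    obtain ⟨f, hf⟩ := exists_free_lift i s.hom.hom
    have hf' : f.app i = s ≫ i₂ := FGModuleCat.hom_ext (LinearMap.ext hf)
    have h := app_isIso _ (hN.isIso_id_add hP (f ≫ r) v) i
    rw [add_app, id_app, Category.assoc, comp_app f, hf', Category.assoc] at h
    exact isIso_id_add_comp_swap _ _ h
  have hfac : Hom.app (u ≫ v) i = (Hom.app (u ≫ j) i ≫ p₁) ≫ i₁ ≫ Hom.app (r ≫ v) i +
      (Hom.app (u ≫ j) i ≫ p₂) ≫ i₂ ≫ Hom.app (r ≫ v) i := by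
    have h : u ≫ v = (u ≫ j) ≫ r ≫ v := by
      rw [Category.assoc, ← Category.assoc j, hj, Category.id_comp]
    have hB : Hom.app (r ≫ v) i = (p₁ ≫ i₁ + p₂ ≫ i₂) ≫ Hom.app (r ≫ v) i := by
      rw [hsum, Category.id_comp]
    rw [h, comp_app (u ≫ j)]
    refine (congrArg (Hom.app (u ≫ j) i ≫ ·) hB).trans ?_
    simp only [Preadditive.add_comp, Preadditive.comp_add, Category.assoc]
  rw [hfac]
  exact (h₁.comp _).add (h₂.precomp _)

end RadicalComponents

/-! ### Gluing factorizations of components -/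

section Gluing

variable {k Λ : Type u} [Field k] [Ring Λ] [Algebra k Λ] {M N : RepMod k Λ}

/-- Degreewise factorizations `M j ⟶ X j ⟶ N j` of a morphism `M ⟶ N` come from a factorization
over the repetitive algebra if the first factor is invertible below the degree `i` and the second
one above it: the structure map of `X` out of the degree `j` is that of `M` for `j < i` and that
of `N` for `i ≤ j`. -/
theorem exists_factorization (h : M ⟶ N) (i : ℤ) (X : ℤ → FGModuleCat.{u} Λ)
    (u : ∀ j, M.obj j ⟶ X j) (v : ∀ j, X j ⟶ N.obj j) (huv : ∀ j, u j ≫ v j = h.app j)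
    (hu : ∀ j < i, IsIso (u j)) (hv : ∀ j > i, IsIso (v j)) :
    ∃ (Z : RepMod k Λ) (a : M ⟶ Z) (b : Z ⟶ N), a ≫ b = h ∧
      (IsSplitMono a → ∀ j, IsSplitMono (u j)) ∧ (IsSplitEpi b → ∀ j, IsSplitEpi (v j)) := by
  have huv' (j : ℤ) (m : M.obj j) : (v j).hom.hom ((u j).hom.hom m) = (h.app j).hom.hom m :=
    congrArg (fun g : M.obj j ⟶ N.obj j => g.hom.hom m) (huv j)
  have hp (j : ℤ) (hj : j < i) : ∃ p : X j →ₗ[Λ] M.obj j,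
      (∀ m, p ((u j).hom.hom m) = m) ∧ ∀ x, (u j).hom.hom (p x) = x := by
    have := hu j hj
    exact ⟨(inv (u j)).hom.hom,
      fun m => congrArg (fun g : M.obj j ⟶ M.obj j => g.hom.hom m) (IsIso.hom_inv_id (u j)),
      fun x => congrArg (fun g : X j ⟶ X j => g.hom.hom x) (IsIso.inv_hom_id (u j))⟩
  have hq (j : ℤ) (hj : i < j) : ∃ q : N.obj j →ₗ[Λ] X j,
      (∀ x, q ((v j).hom.hom x) = x) ∧ ∀ n, (v j).hom.hom (q n) = n := by
    have := hv j hj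
    exact ⟨(inv (v j)).hom.hom,
      fun x => congrArg (fun g : X j ⟶ X j => g.hom.hom x) (IsIso.hom_inv_id (v j)),
      fun n => congrArg (fun g : N.obj j ⟶ N.obj j => g.hom.hom n) (IsIso.inv_hom_id (v j))⟩
  have hact (j : ℤ) : ∃ act : Module.Dual k Λ →+ X j →+ X (j + 1),
      (∀ φ m, act φ ((u j).hom.hom m) = (u (j + 1)).hom.hom (M.act j φ m)) ∧
      ∀ φ x, (v (j + 1)).hom.hom (act φ x) = N.act j φ ((v j).hom.hom x) := by
    rcases lt_or_ge j i with hj | hj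
    · obtain ⟨p, hp₁, hp₂⟩ := hp j hj
      refine ⟨AddMonoidHom.mk' (fun φ => (u (j + 1)).hom.hom.toAddMonoidHom.comp
        ((M.act j φ).comp p.toAddMonoidHom)) fun φ ψ => ?_, fun φ m => ?_, fun φ x => ?_⟩
      · ext x
        change (u (j + 1)).hom.hom (M.act j (φ + ψ) (p x)) =
          (u (j + 1)).hom.hom (M.act j φ (p x)) + (u (j + 1)).hom.hom (M.act j ψ (p x))
        rw [map_add, AddMonoidHom.add_apply, map_add]
      · exact congrArg (fun y => (u (j + 1)).hom.hom (M.act j φ y)) (hp₁ m)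
      · change (v (j + 1)).hom.hom ((u (j + 1)).hom.hom (M.act j φ (p x))) = _
        rw [huv', h.comm, ← huv', hp₂]
    · obtain ⟨q, hq₁, hq₂⟩ := hq (j + 1) (by omega)
      refine ⟨AddMonoidHom.mk' (fun φ => q.toAddMonoidHom.comp
        ((N.act j φ).comp (v j).hom.hom.toAddMonoidHom)) fun φ ψ => ?_, fun φ m => ?_,
        fun φ x => hq₂ _⟩
      · ext x
        change q (N.act j (φ + ψ) ((v j).hom.hom x)) =
          q (N.act j φ ((v j).hom.hom x)) + q (N.act j ψ ((v j).hom.hom x))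
        rw [map_add, AddMonoidHom.add_apply, map_add]
      · change q (N.act j φ ((v j).hom.hom ((u j).hom.hom m))) = _
        rw [huv', ← h.comm, ← huv', hq₁]
  choose act hact₁ hact₂ using hact
  -- The laws hold for `X` where they can be lifted to `M` or pushed forward to `N`.
  have hsurj (j : ℤ) (hj : j < i) : Function.Surjective (u j).hom.hom := fun x => by
    obtain ⟨p, -, hp₂⟩ := hp j hj
    exact ⟨p x, hp₂ x⟩
  have hinj (j : ℤ) (hj : i < j) : Function.Injective (v j).hom.hom := by
    obtain ⟨q, hq₁, -⟩ := hq j hj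
    exact Function.LeftInverse.injective hq₁
  let Z : RepMod k Λ :=
    { obj := X
      finite_support := by
        refine ((M.finite_support.union N.finite_support).union (Set.finite_singleton i)).subset
          fun j hj => ?_
        have hj' : Nontrivial (X j) := hj
        rcases lt_trichotomy j i with hji | rfl | hji
        · exact Or.inl (Or.inl (hsurj j hji).nontrivial)
        · exact Or.inr rfl
        · exact Or.inl (Or.inr (hinj j hji).nontrivial)
      act := act
      act_balanced := fun j φ a x => by
        rcases lt_or_ge j i with hj | hj
        · obtain ⟨m, rfl⟩ := hsurj j hj x
          rw [← map_smul, hact₁, hact₁, M.act_balanced]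
        · apply hinj (j + 1) (by omega)
          rw [hact₂, hact₂, map_smul, N.act_balanced]
      act_smul := fun j a φ x => by
        rcases lt_or_ge j i with hj | hj
        · obtain ⟨m, rfl⟩ := hsurj j hj x
          rw [hact₁, hact₁, M.act_smul, map_smul]
        · apply hinj (j + 1) (by omega)
          rw [hact₂, map_smul, hact₂, N.act_smul]
      act_act := fun j φ ψ x => by
        rcases lt_or_ge j i with hj | hj
        · obtain ⟨m, rfl⟩ := hsurj j hj x
          rw [hact₁, hact₁, M.act_act, map_zero]
        · apply hinj (j + 1 + 1) (by omega)
          rw [hact₂, hact₂, N.act_act, map_zero] }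
  let a : M ⟶ Z := { app := u, comm := fun j φ m => (hact₁ j φ m).symm }
  let b : Z ⟶ N := { app := v, comm := hact₂ }
  exact ⟨Z, a, b, hom_ext huv, fun ha j => app_isSplitMono a j, fun hb j => app_isSplitEpi b j⟩

/-- A factorization of one component of an irreducible morphism extends to a factorization of the
morphism that is trivial in the other degrees. Irreducibility then gives a dichotomy. -/
theorem isSplitMono_or_isSplitEpi_of_comp_eq_app {h : M ⟶ N} (hh : IsIrreducibleMor h) {i : ℤ}
    {Y : FGModuleCat.{u} Λ} (a : M.obj i ⟶ Y) (b : Y ⟶ N.obj i) (hab : a ≫ b = h.app i) :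
    (IsSplitMono a ∧ ∀ j > i, IsSplitMono (h.app j)) ∨
      (IsSplitEpi b ∧ ∀ j < i, IsSplitEpi (h.app j)) := by
  have H (j : ℤ) : ∃ (X : FGModuleCat.{u} Λ) (u : M.obj j ⟶ X) (v : X ⟶ N.obj j),
      u ≫ v = h.app j ∧ (j < i → IsIso u) ∧ (j > i → IsIso v) ∧
        (j = i → (IsSplitMono u → IsSplitMono a) ∧ (IsSplitEpi v → IsSplitEpi b)) := by
    rcases lt_trichotomy j i with hj | rfl | hj
    · exact ⟨M.obj j, 𝟙 _, h.app j, Category.id_comp _, fun _ => inferInstance,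
        fun _ => by omega, fun _ => by omega⟩
    · exact ⟨Y, a, b, hab, fun _ => by omega, fun _ => by omega, fun _ => ⟨id, id⟩⟩
    · exact ⟨N.obj j, h.app j, 𝟙 _, Category.comp_id _, fun _ => by omega,
        fun _ => inferInstance, fun _ => by omega⟩
  choose X u v huv hu hv hi using H
  obtain ⟨Z, a', b', hab', ha', hb'⟩ := exists_factorization h i X u v huv hu hv
  rcases hh.2.2 a' b' hab' with h' | h'
  · refine Or.inl ⟨(hi i rfl).1 (ha' h' i), fun j hj => ?_⟩
    have := ha' h' j
    have := hv j hj
    rw [← huv]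
    infer_instance
  · refine Or.inr ⟨(hi i rfl).2 (hb' h' i), fun j hj => ?_⟩
    have := hb' h' j
    have := hu j hj
    rw [← huv]
    infer_instance

/-- If a component is not a split monomorphism, all components below it are split
epimorphisms. -/
theorem isSplitEpi_app_of_lt {h : M ⟶ N} (hh : IsIrreducibleMor h) {i j : ℤ} (hij : j < i)
    (hi : ¬ IsSplitMono (h.app i)) : IsSplitEpi (h.app j) := by
  rcases isSplitMono_or_isSplitEpi_of_comp_eq_app hh (h.app i) (𝟙 _) (Category.comp_id _) with
    h' | h'
  · exact absurd h'.1 hi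
  · exact h'.2 j hij

/-- An irreducible morphism is smonic, sepic or sirreducible. -/
theorem smonic_or_sepic_or_sirreducible [IsNoetherianRing Λ] {h : M ⟶ N}
    (hh : IsIrreducibleMor h) : Smonic h ∨ Sepic h ∨ Sirreducible h := by
  by_contra! hc
  obtain ⟨hm, he, hs⟩ := hc
  obtain ⟨p, hpm, hpe⟩ : ∃ p, ¬ IsSplitMono (h.app p) ∧ ¬ IsSplitEpi (h.app p) := by
    rcases injective_or_surjective_of_irreducible hh with hi | hi
    · obtain ⟨p, hp⟩ := not_forall.1 hm
      exact ⟨p, hp, fun h' => hp (isSplitMono_of_isSplitEpi_of_injective h' (hi p))⟩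
    · obtain ⟨p, hp⟩ := not_forall.1 he
      exact ⟨p, fun h' => hp (isSplitEpi_of_isSplitMono_of_surjective h' (hi p)), hp⟩
  refine hs ⟨hh, p, ⟨hpm, hpe, fun Y a b hab => ?_⟩, fun i him hie => ?_⟩
  · exact (isSplitMono_or_isSplitEpi_of_comp_eq_app hh a b hab).imp And.left And.left
  · rcases lt_trichotomy i p with hip | hip | hip
    · exact absurd (isSplitEpi_app_of_lt hh hip hpm) hie
    · exact hip
    · exact absurd (isSplitEpi_app_of_lt hh hip him) hpe

end Gluing

/-! ### Representatives of morphisms of the stable category -/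

section Stable

variable {k Λ : Type u} [Field k] [Ring Λ] [Algebra k Λ] {M N : RepMod k Λ}

theorem exists_eq_add_of_toStable_map_eq {f g : M ⟶ N}
    (h : (toStable k Λ).map f = (toStable k Λ).map g) :
    ∃ (P : RepMod k Λ) (u : M ⟶ P) (v : P ⟶ N), Projective P ∧ f = g + u ≫ v := by
  obtain ⟨P, u, v, hP, -, huv⟩ := (Quotient.functor_map_eq_iff (stableRel k Λ) f g).1 h
  exact ⟨P, u, v, hP, by rw [← huv, add_sub_cancel]⟩

theorem isSplitMono_of_toStable_map [IsArtinianRing Λ] (hM : M.NoProjectiveSummand) {f : M ⟶ N}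
    (hf : IsSplitMono ((toStable k Λ).map f)) : IsSplitMono f := by
  obtain ⟨w, hw⟩ := (toStable k Λ).map_surjective (retraction ((toStable k Λ).map f))
  have h : (toStable k Λ).map (f ≫ w) = (toStable k Λ).map (𝟙 M) := by
    rw [Functor.map_comp, hw, IsSplitMono.id, CategoryTheory.Functor.map_id]
  obtain ⟨P, u, v, hP, huv⟩ := exists_eq_add_of_toStable_map_eq h
  have := hM.isIso_id_add hP u v
  exact IsSplitMono.mk' ⟨w ≫ inv (𝟙 M + u ≫ v), by
    rw [← Category.assoc, huv, IsIso.hom_inv_id]⟩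

theorem isSplitEpi_of_toStable_map [IsArtinianRing Λ] (hN : N.NoProjectiveSummand) {f : M ⟶ N}
    (hf : IsSplitEpi ((toStable k Λ).map f)) : IsSplitEpi f := by
  obtain ⟨w, hw⟩ := (toStable k Λ).map_surjective (section_ ((toStable k Λ).map f))
  have h : (toStable k Λ).map (w ≫ f) = (toStable k Λ).map (𝟙 N) := by
    rw [Functor.map_comp, hw, IsSplitEpi.id, CategoryTheory.Functor.map_id]
  obtain ⟨P, u, v, hP, huv⟩ := exists_eq_add_of_toStable_map_eq h
  have := hN.isIso_id_add hP u v
  exact IsSplitEpi.mk' ⟨inv (𝟙 N + u ≫ v) ≫ w, by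
    rw [Category.assoc, huv, IsIso.inv_hom_id]⟩

/-- Between modules without projective summands, every representative of an irreducible morphism
of the stable category is irreducible. -/
theorem isIrreducibleMor_of_toStable_map [IsArtinianRing Λ] (hM : M.NoProjectiveSummand)
    (hN : N.NoProjectiveSummand) {h : M ⟶ N} (hh : IsIrreducibleMor ((toStable k Λ).map h)) :
    IsIrreducibleMor h := by
  refine ⟨fun h' => hh.1 inferInstance, fun h' => hh.2.1 inferInstance, fun Z u v huv => ?_⟩
  refine (hh.2.2 ((toStable k Λ).map u) ((toStable k Λ).map v) ?_).imp
    (isSplitMono_of_toStable_map hM) (isSplitEpi_of_toStable_map hN)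
  rw [← Functor.map_comp, huv]

variable [FiniteDimensional k Λ]

theorem isSplitMono_app_of_toStable_map_eq (hM : M.NoProjectiveSummand)
    (hN : N.NoProjectiveSummand) {f g : M ⟶ N}
    (h : (toStable k Λ).map f = (toStable k Λ).map g) {i : ℤ} (hg : IsSplitMono (g.app i)) :
    IsSplitMono (f.app i) := by
  obtain ⟨P, u, v, hP, rfl⟩ := exists_eq_add_of_toStable_map_eq h
  exact (isRadicalMor_app_of_projective hM hN hP u v i).isSplitMono_add hg

theorem isSplitEpi_app_of_toStable_map_eq (hM : M.NoProjectiveSummand)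
    (hN : N.NoProjectiveSummand) {f g : M ⟶ N}
    (h : (toStable k Λ).map f = (toStable k Λ).map g) {i : ℤ} (hg : IsSplitEpi (g.app i)) :
    IsSplitEpi (f.app i) := by
  obtain ⟨P, u, v, hP, rfl⟩ := exists_eq_add_of_toStable_map_eq h
  exact (isRadicalMor_app_of_projective hM hN hP u v i).isSplitEpi_add hg

end Stable

end RepMod

end

theorem theorem3p2 {k Λ : Type u} [Field k] [IsAlgClosed k] [Ring Λ] [Algebra k Λ]
    [FiniteDimensional k Λ] {M N : RepMod k Λ}
    (φ : (toStable k Λ).obj M ⟶ (toStable k Λ).obj N) (hφ : IsIrreducibleMor φ)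
    (hind : Indecomposable M ∨ Indecomposable N)
    (hM : M.NoProjectiveSummand) (hN : N.NoProjectiveSummand) :
    StablySmonic φ ∨ StablySepic φ ∨ StablySirreducible φ := by
  have : IsArtinianRing Λ := IsArtinianRing.of_finite k Λ
  obtain ⟨h, rfl⟩ := (toStable k Λ).map_surjective φ
  have hirr (g : M ⟶ N) (hg : (toStable k Λ).map g = (toStable k Λ).map h) :
      RepMod.Smonic g ∨ RepMod.Sepic g ∨ RepMod.Sirreducible g :=
    RepMod.smonic_or_sepic_or_sirreducible
      (RepMod.isIrreducibleMor_of_toStable_map hM hN (hg ▸ hφ))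
  by_cases hm : RepMod.Smonic h
  · exact Or.inl fun g hg i => RepMod.isSplitMono_app_of_toStable_map_eq hM hN hg (hm i)
  by_cases he : RepMod.Sepic h
  · exact Or.inr (Or.inl fun g hg i =>
      RepMod.isSplitEpi_app_of_toStable_map_eq hM hN hg (he i))
  refine Or.inr (Or.inr fun g hg => ?_)
  rcases hirr g hg with hgm | hge | hgs
  · exact absurd (fun i => RepMod.isSplitMono_app_of_toStable_map_eq hM hN hg.symm (hgm i)) hm
  · exact absurd (fun i => RepMod.isSplitEpi_app_of_toStable_map_eq hM hN hg.symm (hge i)) he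
  · exact hgs
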